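/- For a finite connected simple graph $G$ with shortest-path metric $d$, and a finite sequence of vertices $(x_0,\ldots,x_k)$, put $\ell(x_0,\ldots,x_k)=\sum_{i=0}^{k-1}d(x_i,x_{i+1})$. For integers $k,l$ let $\mathrm{MC}_{k,l}(G)$ be the free abelian group on the sequences $(x_0,\ldots,x_k)\in V(G)^{k+1}$ such that $x_i\neq x_{i+1}$ for all $i$ and $\ell(x_0,\ldots,x_k)=l$ (so $\mathrm{MC}_{k,l}(G)=0$ if $k<0$ or $l<0$). The differential $\partial:\mathrm{MC}_{k,l}(G)\to \mathrm{MC}_{k-1,l}(G)$ is $\partial=\sum_{1\le i\le k-1}(-1)^i\partial_i$, where $\partial_i(x_0,\ldots,x_k)=(x_0,\ldots,\widehat{x_i},\ldots,x_k)$ if $\ell(x_0,\ldots,\widehat{x_i},\ldots,x_k)=\ell(x_0,\ldots,x_k)$, and $\partial_i(x_0,\ldots,x_k)=0$ otherwise. The magnitude homology of $G$ is $\mathrm{MH}_{k,l}(G)=H_k(\mathrm{MC}_{*,l}(G))$. **Theorem.** Let $m\ge 2$ be an integer and let $C_{2m+1}$ be the cycle graph on $2m+1$ vertices. 1. For all integers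 $k,l$, the group $\mathrm{MH}_{k,l}(C_{2m+1})$ is torsion-free. 2. Define $T:\mathbb Z\times\mathbb Z\to\mathbb Z$ recursively by (a) $T(k,l)=0$ if $k<0$ or $l<0$; (b) $T(0,0)=2m+1$ and $T(1,1)=4m+2$; (c) $T(k,l)=T(k-1,l-1)+2\,T(k-2,l-(m+1))$ for all other $(k,l)$, that is, for $k,l\ge 0$ with $(k,l)\ne(0,0),(1,1)$. Then, for all integers $k,l$, the group $\mathrm{MH}_{k,l}(C_{2m+1})$ is finitely generated and $\operatorname{rk}\mathrm{MH}_{k,l}(C_{2m+1})=T(k,l)$. -/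

import Mathlib

namespace MagnitudeHomology

variable {V : Type*} (G : SimpleGraph V)

/-- The length `ℓ(x₀, …, x_k) = ∑ d(x_i, x_{i+1})` of a sequence of vertices, for the shortest-path
metric `d` of the graph. -/
noncomputable def pathLength : List V → ℕ
  | [] => 0
  | [_] => 0
  | a :: b :: x => G.dist a b + pathLength (b :: x)

/-- `x` is one of the sequences `(x₀, …, x_k)` of vertices with `x_i ≠ x_{i+1}` for all `i` and
`ℓ(x₀, …, x_k) = l`. There are none if `k < 0` or `l < 0`. -/
structure IsGenerator (k l : ℤ) (x : List V) : Prop where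
  ne_nil : x ≠ []
  length_eq : (x.length : ℤ) = k + 1
  isChain : x.IsChain (· ≠ ·)
  pathLength_eq : (pathLength G x : ℤ) = l

/-- The magnitude chain group `MC_{k,l}(G)`: the free abelian group on the sequences above. -/
abbrev MC (k l : ℤ) : Type _ := {x : List V // IsGenerator G k l x} →₀ ℤ

open Classical in
/-- The sequence `y`, seen as an element of `MC_{k,l}(G)`, if it is a generator of that group,
and `0` otherwise. -/
noncomputable def ofSeq (k l : ℤ) (y : List V) : MC G k l :=
  if h : IsGenerator G k l y then Finsupp.single ⟨y, h⟩ 1 else 0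

/-- The differential `∂ : MC_{k,l}(G) → MC_{j,l}(G)`, meant for `j = k - 1`:
`∂ (x₀, …, x_k) = ∑_{1 ≤ i ≤ k-1} (-1)^i ∂_i (x₀, …, x_k)`, where `∂_i` omits `x_i` if this does
not change the length of the sequence, and is `0` otherwise
(see `ofSeq_eraseIdx_eq` and `isGenerator_eraseIdx_iff`).
The target degree is a variable only to avoid casts between `k + 1 - 1` and `k`. -/
noncomputable def differential (k j l : ℤ) : MC G k l →ₗ[ℤ] MC G j l :=
  Finsupp.lift (MC G j l) ℤ _ fun x =>
    ∑ i ∈ Finset.Ioo 0 (x.1.length - 1), (-1 : ℤ) ^ i • ofSeq G j l (x.1.eraseIdx i)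

/-- The magnitude homology group `MH_{k,l}(G) = H_k(MC_{*,l}(G))`: the kernel of
`∂ : MC_{k,l}(G) → MC_{k-1,l}(G)` modulo the image of `∂ : MC_{k+1,l}(G) → MC_{k,l}(G)`. -/
abbrev MH (k l : ℤ) : Type _ :=
  LinearMap.ker (differential G k (k - 1) l) ⧸
    (LinearMap.range (differential G (k + 1) k l)).submoduleOf
      (LinearMap.ker (differential G k (k - 1) l))

variable {G}

/-- Omitting an interior entry does not increase the length. -/
theorem pathLength_eraseIdx_le (hG : G.Connected) (x : List V) (i : ℕ) :
    pathLength G (x.eraseIdx i) ≤ pathLength G x := by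
  induction x generalizing i with
  | nil => simp
  | cons a x ih =>
    cases i with
    | zero => cases x <;> simp [pathLength]
    | succ i =>
      cases x with
      | nil => simp
      | cons b x =>
        cases i with
        | zero =>
          cases x with
          | nil => simp [pathLength]
          | cons c x =>
            have := hG.dist_triangle (u := a) (v := b) (w := c)
            simp only [List.eraseIdx_cons_succ, List.eraseIdx_cons_zero, pathLength]
            omega
        | succ i =>
          have := ih (i + 1)
          simp only [List.eraseIdx_cons_succ, pathLength] at this ⊢
          omega

theorem isChain_eraseIdx (hG : G.Connected) (x : List V) (i : ℕ)
    (hx : x.IsChain (· ≠ ·)) (h : pathLength G (x.eraseIdx i) = pathLength G x) :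
    (x.eraseIdx i).IsChain (· ≠ ·) := by
  induction x generalizing i with
  | nil => simp
  | cons a x ih =>
    cases i with
    | zero => simpa using hx.tail
    | succ i =>
      cases x with
      | nil => simp
      | cons b x =>
        rw [List.isChain_cons_cons] at hx
        cases i with
        | zero =>
          cases x with
          | nil => simp
          | cons c x =>
            simp only [List.eraseIdx_cons_succ, List.eraseIdx_cons_zero, pathLength,
              List.isChain_cons_cons] at h hx ⊢
            refine ⟨?_, hx.2.2⟩
            rintro rfl
            have := hG.pos_dist_of_ne hx.1
            simp at h
            omega
        | succ i =>
          have := ih (i + 1) hx.2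
          simp only [List.eraseIdx_cons_succ, pathLength, List.isChain_cons_cons] at this h ⊢
          exact ⟨hx.1, this (by omega)⟩

/-- In a connected graph, a face of a generator is again a generator exactly when the
length does not change. -/
theorem isGenerator_eraseIdx_iff (hG : G.Connected) {k l : ℤ} {x : List V}
    (hx : IsGenerator G k l x) {i : ℕ} (h0 : 0 < i) (hi : i < x.length - 1) :
    IsGenerator G (k - 1) l (x.eraseIdx i) ↔ pathLength G (x.eraseIdx i) = pathLength G x := by
  have hl := hx.length_eq
  have hp := hx.pathLength_eq
  have hlen := List.length_eraseIdx_of_lt (l := x) (i := i) (by omega)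
  constructor
  · intro h
    have := h.pathLength_eq
    omega
  · intro h
    refine ⟨?_, by omega, isChain_eraseIdx hG x i hx.isChain h, by omega⟩
    intro h'
    rw [h'] at hlen
    simp at hlen
    omega

open Classical in
/-- In a connected graph, the `i`-th term of the differential is as in its description. -/
theorem ofSeq_eraseIdx_eq (hG : G.Connected) {k l : ℤ} {x : List V}
    (hx : IsGenerator G k l x) {i : ℕ} (h0 : 0 < i) (hi : i < x.length - 1) :
    ofSeq G (k - 1) l (x.eraseIdx i) =
      if h : pathLength G (x.eraseIdx i) = pathLength G x then
        Finsupp.single ⟨x.eraseIdx i, (isGenerator_eraseIdx_iff hG hx h0 hi).2 h⟩ 1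
      else 0 := by
  unfold ofSeq
  simp only [isGenerator_eraseIdx_iff hG hx h0 hi]

theorem differential_single (k j l : ℤ) (x : {x : List V // IsGenerator G k l x}) :
    differential G k j l (Finsupp.single x 1) =
      ∑ i ∈ Finset.Ioo 0 (x.1.length - 1), (-1 : ℤ) ^ i • ofSeq G j l (x.1.eraseIdx i) := by
  simp [differential]

theorem eraseIdx_eraseIdx_of_lt (x : List V) {i j : ℕ} (h : j < i) :
    (x.eraseIdx i).eraseIdx j = (x.eraseIdx j).eraseIdx (i - 1) := by
  induction x generalizing i j with
  | nil => simp
  | cons a x ih =>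
    obtain ⟨i, rfl⟩ : ∃ n, i = n + 1 := ⟨i - 1, by omega⟩
    cases j with
    | zero => simp
    | succ j =>
      obtain ⟨i, rfl⟩ : ∃ n, i = n + 1 := ⟨i - 1, by omega⟩
      simpa using ih (i := i + 1) (j := j) (by omega)

/-- The differential of the magnitude chain complex of a connected graph squares to zero. -/
theorem differential_comp_differential (hG : G.Connected) (k l : ℤ) :
    differential G k (k - 1) l ∘ₗ differential G (k + 1) k l = 0 := by
  refine Finsupp.lhom_ext' fun x => LinearMap.ext_ring ?_
  simp only [LinearMap.comp_apply, Finsupp.lsingle_apply, differential_single, map_sum, map_zsmul,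
    LinearMap.zero_apply, LinearMap.zero_comp]
  obtain ⟨x, hx⟩ := x
  have hl := hx.length_eq
  have key : ∀ i ∈ Finset.Ioo 0 (x.length - 1),
      (-1 : ℤ) ^ i • differential G k (k - 1) l (ofSeq G k l (x.eraseIdx i)) =
      ∑ j ∈ Finset.Ioo 0 (x.length - 2),
        (-1 : ℤ) ^ (i + j) • ofSeq G (k - 1) l ((x.eraseIdx i).eraseIdx j) := by
    intro i hi
    rw [Finset.mem_Ioo] at hi
    have hlen := List.length_eraseIdx_of_lt (l := x) (i := i) (by omega)
    by_cases h : IsGenerator G k l (x.eraseIdx i)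
    · rw [ofSeq, dif_pos h, differential_single, Finset.smul_sum]
      simp only [hlen, smul_smul, pow_add]
      rfl
    · rw [ofSeq, dif_neg h, map_zero, smul_zero, eq_comm]
      refine Finset.sum_eq_zero fun j hj => ?_
      rw [ofSeq, dif_neg, smul_zero]
      intro h'
      apply h
      have h1 := isGenerator_eraseIdx_iff hG hx hi.1 hi.2
      rw [add_sub_cancel_right] at h1
      rw [h1]
      have h2 := pathLength_eraseIdx_le hG (x.eraseIdx i) j
      have h3 := pathLength_eraseIdx_le hG x i
      have h4 := h'.pathLength_eq
      have h5 := hx.pathLength_eq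
      omega
  rw [Finset.sum_congr rfl key, ← Finset.sum_product']
  refine Finset.sum_involution
    (fun p _ => if p.2 < p.1 then (p.2, p.1 - 1) else (p.2 + 1, p.1)) ?_ ?_ ?_ ?_
  · rintro ⟨i, j⟩ hp
    simp only [Finset.mem_product, Finset.mem_Ioo] at hp
    dsimp only
    split_ifs with h
    · rw [eraseIdx_eraseIdx_of_lt x h]
      obtain ⟨i, rfl⟩ : ∃ n, i = n + 1 := ⟨i - 1, by omega⟩
      rw [← add_smul, show i + 1 + j = (j + i) + 1 by ring, Nat.add_sub_cancel, pow_succ]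
      simp
    · rw [eraseIdx_eraseIdx_of_lt x (show i < j + 1 by omega), Nat.add_sub_cancel, ← add_smul,
        show j + 1 + i = (i + j) + 1 by ring, pow_succ]
      simp
  · rintro ⟨i, j⟩ hp _
    dsimp only
    split_ifs with h <;> simp only [ne_eq, Prod.mk.injEq] <;> omega
  · rintro ⟨i, j⟩ hp
    simp only [Finset.mem_product, Finset.mem_Ioo] at hp ⊢
    split_ifs with h <;> dsimp only <;> omega
  · rintro ⟨i, j⟩ hp
    simp only [Finset.mem_product, Finset.mem_Ioo] at hp
    by_cases h : j < i
    · simp only [h, if_true]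
      rw [if_neg (by omega)]
      ext <;> dsimp only <;> omega
    · simp only [h, if_false]
      rw [if_pos (by omega)]
      ext <;> dsimp only <;> omega

/-- The function `T : ℤ × ℤ → ℤ` (for a given `m`): `T(k,l) = 0` if `k < 0` or `l < 0`,
`T(0,0) = 2m+1`, `T(1,1) = 4m+2`, and `T(k,l) = T(k-1,l-1) + 2 T(k-2,l-(m+1))` otherwise. -/
def oddCycleT (m : ℕ) (k l : ℤ) : ℤ :=
  if k < 0 ∨ l < 0 then 0
  else if k = 0 ∧ l = 0 then 2 * m + 1
  else if k = 1 ∧ l = 1 then 4 * m + 2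
  else oddCycleT m (k - 1) (l - 1) + 2 * oddCycleT m (k - 2) (l - (m + 1))
termination_by (k + 1).toNat
decreasing_by all_goals omega

end MagnitudeHomology

namespace MagnitudeHomology

/-! ### The complex of step words

A pair `(e, a)` stands for a step of length `a + 1` in the direction `e` along a cycle. -/

/-! On an odd cycle any two vertices are joined by a unique shortest path, so a generator of `MC
(oddCycle m) k l` is a starting vertex together with a word of `k` directed steps of lengths between
`1` and `m`. Omitting an interior vertex keeps the length exactly when the two adjacent steps have
the same direction and lengths adding up to at most `m`. The magnitude complex is therefore `2 * m +
1` copies of a complex of words whose differential merges neighbouring steps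
(`differential_pathMap`).

On words, splitting a unit off the first step contracts almost everything. What survives at the head
is a lone unit step, a unit step followed by a change of direction, or two steps in one direction of
total length `m + 1`; in the last case all splittings of `m + 1` are identified with `1, m`.
Recursion on the rest gives `h` and `p` with `d h + h d = 1 - p` (`dMap_hWord_add_hMap_dWord`),
where `p` projects onto the span of the critical words, all of which are cycles. Then `p d = 0` is
formal, and homology is free on the critical generators (`nonempty_MH_equiv`).

Counting gives the recursion: a nonempty critical word can be preceded by a turning unit step in one
way, and any critical word by a block `1, m` in two ways (`card_critical_add_two`). The empty word
can be preceded by a unit step in either direction, hence the exceptional value at `(1, 1)`. -/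

/-- A step of length `a + 1` in one of the two directions. -/
abbrev Step := Bool × ℕ

/-- The free abelian group on finite sequences of steps. -/
abbrev Words := List Step →₀ ℤ

namespace Words

/-- The linear extension of a function on words. -/
noncomputable abbrev extend {M : Type*} [AddCommGroup M] (f : List Step → M) : Words →ₗ[ℤ] M :=
  Finsupp.lift M ℤ (List Step) f

/-- The word `s`, as an element of the free abelian group. -/
noncomputable abbrev word (s : List Step) : Words := Finsupp.single s 1

theorem extend_word {M : Type*} [AddCommGroup M] (f : List Step → M) (s : List Step) :
    extend f (word s) = f s := by
  simp [extend]

theorem hom_ext {M : Type*} [AddCommGroup M] {f g : Words →ₗ[ℤ] M}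
    (h : ∀ s, f (word s) = g (word s)) : f = g :=
  Finsupp.lhom_ext' fun s => LinearMap.ext_ring (h s)

/-- Put a step in front of every word. -/
noncomputable def consMap (t : Step) : Words →ₗ[ℤ] Words := extend fun s => word (t :: s)

@[simp] theorem consMap_word (t : Step) (s : List Step) :
    consMap t (word s) = word (t :: s) := extend_word _ _

/-- Merge a step with the first step of a word, if the result is a step of length at most `m`
which is as long as both together. -/
noncomputable def mergeWord (m : ℕ) (t : Step) : List Step → Words
  | [] => 0
  | u :: s => if t.1 = u.1 ∧ t.2 + u.2 + 1 < m then word ((t.1, t.2 + u.2 + 1) :: s) else 0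

/-- The linear extension of `mergeWord`. -/
noncomputable def mergeMap (m : ℕ) (t : Step) : Words →ₗ[ℤ] Words := extend (mergeWord m t)

@[simp] theorem mergeMap_word (m : ℕ) (t : Step) (s : List Step) :
    mergeMap m t (word s) = mergeWord m t s := extend_word _ _

/-- The differential of a word. -/
noncomputable def dWord (m : ℕ) : List Step → Words
  | [] => 0
  | t :: s => -mergeWord m t s - consMap t (dWord m s)

/-- The differential on words: the alternating sum over all ways to merge neighbouring steps. -/
noncomputable def dMap (m : ℕ) : Words →ₗ[ℤ] Words := extend (dWord m)

@[simp] theorem dMap_word (m : ℕ) (s : List Step) : dMap m (word s) = dWord m s := extend_word _ _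

/-! ### Projection and contracting homotopy on words -/

/-- The projection of a word to the span of the critical words. -/
noncomputable def pWord (m : ℕ) : List Step → Words
  | [] => word []
  | [t] => if t.2 = 0 then word [t] else 0
  | t :: u :: s =>
    if t.1 = u.1 then
      -- Second components are lengths minus one: the two lengths add up to `m + 1`, the least total
      -- that cannot be merged.
      if t.2 + u.2 + 1 = m then consMap (t.1, 0) (consMap (t.1, m - 1) (pWord m s)) else 0
    else if t.2 = 0 then consMap (t.1, 0) (pWord m (u :: s)) else 0

/-- The part of the homotopy which splits off a unit from the first step of a word. -/
noncomputable def splitWord (t : Step) (s : List Step) : Words :=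
  if t.2 = 0 then 0 else -word ((t.1, 0) :: (t.1, t.2 - 1) :: s)

/-- The homotopy between the identity and the projection to the span of the critical words. -/
noncomputable def hWord (m : ℕ) : List Step → Words
  | [] => 0
  | [t] => splitWord t []
  | t :: u :: s =>
    splitWord t (u :: s) +
      if t.1 = u.1 then
        if t.2 + u.2 + 1 = m then consMap (t.1, 0) (consMap (t.1, m - 1) (hWord m s)) else 0
      -- The sign matches `d (t :: z) = … - t :: d z`; passing a block of two steps needs none.
      else if t.2 = 0 then -consMap (t.1, 0) (hWord m (u :: s)) else 0

/-- The linear extension of `hWord`. -/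
noncomputable def hMap (m : ℕ) : Words →ₗ[ℤ] Words := extend (hWord m)

@[simp] theorem hMap_word (m : ℕ) (s : List Step) : hMap m (word s) = hWord m s := extend_word _ _

/-- The part of `hWord m (t :: s)` which comes from the homotopy on shorter words. -/
noncomputable def tailWord (m : ℕ) (t : Step) : List Step → Words
  | [] => 0
  | u :: s =>
    if t.1 = u.1 then
      if t.2 + u.2 + 1 = m then consMap (t.1, 0) (consMap (t.1, m - 1) (hWord m s)) else 0
    else if t.2 = 0 then -consMap (t.1, 0) (hWord m (u :: s)) else 0

/-- The linear extension of `tailWord`. -/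
noncomputable def tailMap (m : ℕ) (t : Step) : Words →ₗ[ℤ] Words := extend (tailWord m t)

@[simp] theorem tailMap_word (m : ℕ) (t : Step) (s : List Step) :
    tailMap m t (word s) = tailWord m t s := extend_word _ _

/-- Isolating the tail part makes `h` of `t :: z` available for combinations `z` of words, such as
`dWord m s`. -/
theorem hWord_cons (m : ℕ) (t : Step) (s : List Step) :
    hWord m (t :: s) = splitWord t s + tailWord m t s := by
  cases s <;> simp [hWord, tailWord]

theorem dMap_consMap (m : ℕ) (t : Step) (z : Words) :
    dMap m (consMap t z) = -mergeMap m t z - consMap t (dMap m z) := by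
  suffices dMap m ∘ₗ consMap t = -mergeMap m t - consMap t ∘ₗ dMap m from
    LinearMap.congr_fun this z
  exact hom_ext fun s => by simp [dWord]

theorem hMap_consMap_zero (m : ℕ) (e : Bool) (z : Words) :
    hMap m (consMap (e, 0) z) = tailMap m (e, 0) z := by
  suffices hMap m ∘ₗ consMap (e, 0) = tailMap m (e, 0) from LinearMap.congr_fun this z
  exact hom_ext fun s => by simp [hWord_cons, splitWord]

theorem hMap_consMap_succ (m : ℕ) (e : Bool) (a : ℕ) (z : Words) :
    hMap m (consMap (e, a + 1) z) =
      -consMap (e, 0) (consMap (e, a) z) + tailMap m (e, a + 1) z := by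
  suffices hMap m ∘ₗ consMap (e, a + 1) =
    -(consMap (e, 0) ∘ₗ consMap (e, a)) + tailMap m (e, a + 1) from LinearMap.congr_fun this z
  exact hom_ext fun s => by simp [hWord_cons, splitWord]

theorem mergeMap_consMap (m : ℕ) (t u : Step) (z : Words) :
    mergeMap m t (consMap u z) =
      if t.1 = u.1 ∧ t.2 + u.2 + 1 < m then consMap (t.1, t.2 + u.2 + 1) z else 0 := by
  suffices mergeMap m t ∘ₗ consMap u =
    if t.1 = u.1 ∧ t.2 + u.2 + 1 < m then consMap (t.1, t.2 + u.2 + 1) else 0 by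
      rw [← LinearMap.comp_apply, this]; split_ifs <;> rfl
  refine hom_ext fun s => ?_
  simp only [LinearMap.comp_apply, consMap_word, mergeMap_word, mergeWord]
  split_ifs <;> simp

/-- A step of length at least `m` absorbs nothing. This shields a block `1, m` from what follows it.
-/
theorem mergeMap_of_le {m : ℕ} {t : Step} (ht : m ≤ t.2 + 1) (z : Words) :
    mergeMap m t z = 0 := by
  suffices mergeMap m t = 0 from LinearMap.congr_fun this z
  refine hom_ext fun s => ?_
  cases s with
  | nil => simp [mergeWord]
  | cons u s => simp [mergeWord]; omega

theorem tailMap_consMap_same (m : ℕ) (e : Bool) (a c : ℕ) (z : Words) :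
    tailMap m (e, a) (consMap (e, c) z) =
      if a + c + 1 = m then consMap (e, 0) (consMap (e, m - 1) (hMap m z)) else 0 := by
  suffices tailMap m (e, a) ∘ₗ consMap (e, c) =
    if a + c + 1 = m then consMap (e, 0) ∘ₗ consMap (e, m - 1) ∘ₗ hMap m else 0 by
      rw [← LinearMap.comp_apply, this]; split_ifs <;> rfl
  refine hom_ext fun s => ?_
  simp only [LinearMap.comp_apply, consMap_word, tailMap_word, tailWord]
  split_ifs <;> simp

theorem tailMap_consMap_ne (m : ℕ) {e f : Bool} (hef : e ≠ f) (a c : ℕ) (z : Words) :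
    tailMap m (e, a) (consMap (f, c) z) =
      if a = 0 then -consMap (e, 0) (hMap m (consMap (f, c) z)) else 0 := by
  suffices tailMap m (e, a) ∘ₗ consMap (f, c) =
    if a = 0 then -(consMap (e, 0) ∘ₗ hMap m ∘ₗ consMap (f, c)) else 0 by
      rw [← LinearMap.comp_apply, this]; split_ifs <;> rfl
  refine hom_ext fun s => ?_
  simp only [LinearMap.comp_apply, consMap_word, tailMap_word, tailWord, if_neg hef]
  split_ifs <;> simp

/-- Both sides are nonzero only if the three lengths involved add up to `m + 1`, and then every
partial merge is allowed. A merged first step is longer than a unit, so a following turn contributes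
nothing. -/
theorem tailMap_mergeWord_same (m : ℕ) (e : Bool) (a c : ℕ) (s : List Step) :
    tailMap m (e, a) (mergeWord m (e, c) s) =
      if a + c + 1 < m then tailWord m (e, a + c + 1) s else 0 := by
  rcases s with _ | ⟨⟨f, b⟩, s⟩
  · simp [mergeWord, tailWord]
  by_cases hf : e = f
  · subst hf
    simp only [mergeWord, tailWord, true_and, if_true]
    by_cases h : a + c + 1 + b + 1 = m
    · rw [if_pos (by omega), if_pos (by omega), if_pos (by omega), tailMap_word, tailWord]
      simp only [if_true]
      rw [if_pos (by omega)]
    · rw [if_neg h, ite_self]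
      split_ifs
      · rw [tailMap_word, tailWord]
        simp only [if_true]
        rw [if_neg (by omega)]
      · simp
  · simp [mergeWord, tailWord, hf]

theorem tailMap_mergeWord_ne (m : ℕ) {e f : Bool} (hef : e ≠ f) (a c : ℕ) (s : List Step) :
    tailMap m (e, a) (mergeWord m (f, c) s) =
      if a = 0 then -consMap (e, 0) (hMap m (mergeWord m (f, c) s)) else 0 := by
  rcases s with _ | ⟨u, s⟩
  · simp [mergeWord]
  simp only [mergeWord]
  split_ifs with h1 h2 <;> simp_all [tailWord]

/-- Every word occurring in `h` starts with a unit step in the original initial direction `f`. -/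
theorem mergeMap_hWord_ne (m : ℕ) {e f : Bool} (hef : e ≠ f) (a c : ℕ) (s : List Step) :
    mergeMap m (e, a) (hWord m ((f, c) :: s)) = 0 := by
  have key : ∀ z, mergeMap m (e, a) (consMap (f, 0) z) = 0 := fun z => by
    simp [mergeMap_consMap, hef]
  rw [hWord_cons, map_add]
  have h1 : mergeMap m (e, a) (splitWord (f, c) s) = 0 := by
    rw [splitWord]
    split_ifs
    · simp
    · simp [mergeWord, hef]
  rw [h1, zero_add]
  rcases s with _ | ⟨u, s⟩
  · simp [tailWord]
  · simp only [tailWord]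
    split_ifs <;> simp [key]

/-- The homotopy identity on words whose steps have length at most `m`. -/
theorem dMap_hWord_add_hMap_dWord (m : ℕ) :
    ∀ s : List Step, (∀ t ∈ s, t.2 < m) →
      dMap m (hWord m s) + hMap m (dWord m s) = word s - pWord m s
  | [], _ => by simp [hWord, dWord, pWord]
  | [(e, 0)], _ => by simp [hWord, dWord, pWord, splitWord, mergeWord]
  | [(e, a + 1)], h => by
    have : a + 1 < m := by simpa using h
    simp [hWord, dWord, pWord, splitWord, mergeWord, this]
  | (e, a) :: (f, c) :: s, h => by
    have ha : a < m := h (e, a) (by simp)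
    have hc : c < m := h (f, c) (by simp)
    by_cases hef : e = f
    · subst hef
      have IH := dMap_hWord_add_hMap_dWord m s fun t ht => h t (by simp [ht])
      have hp : pWord m ((e, a) :: (e, c) :: s) =
        if a + c + 1 = m then consMap (e, 0) (consMap (e, m - 1) (pWord m s)) else 0 := by
          simp [pWord]
      have ht : tailWord m (e, a) ((e, c) :: s) =
        if a + c + 1 = m then consMap (e, 0) (consMap (e, m - 1) (hWord m s)) else 0 := by
          simp [tailWord]
      have hd : dWord m ((e, a) :: (e, c) :: s) =
          -(if a + c + 1 < m then word ((e, a + c + 1) :: s) else 0) -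
            consMap (e, a) (dWord m ((e, c) :: s)) := by
        simp [dWord, mergeWord]
      have hdc : dWord m ((e, c) :: s) = -mergeWord m (e, c) s - consMap (e, c) (dWord m s) := rfl
      have htail : tailMap m (e, a) (dWord m ((e, c) :: s)) =
          -(if a + c + 1 < m then tailWord m (e, a + c + 1) s else 0) -
          if a + c + 1 = m then consMap (e, 0) (consMap (e, m - 1) (hMap m (dWord m s))) else 0 := by
        rw [hdc, map_sub, map_neg, tailMap_mergeWord_same, tailMap_consMap_same]
      -- The block `1, m` merges neither internally nor with its successor, and the signs of its two
      -- steps cancel.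
      have hdd : ∀ z, dMap m (consMap (e, 0) (consMap (e, m - 1) z)) =
          consMap (e, 0) (consMap (e, m - 1) (dMap m z)) := by
        intro z
        rw [dMap_consMap, dMap_consMap, mergeMap_of_le (t := (e, m - 1)) (by simp only; omega),
          mergeMap_consMap, if_neg (by simp only; omega)]
        simp
      have IH' := congrArg (fun z => consMap (e, 0) (consMap (e, m - 1) z)) IH
      simp only [map_add, map_sub, consMap_word] at IH'
      cases a with
      | zero =>
        rw [hWord_cons, ht, hd, hp, map_sub, hMap_consMap_zero, htail]
        -- Either the two steps merge, and splitting the merged step gives the word back, or the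
        -- word starts with the block `1, m` and the induction hypothesis for `s` applies.
        by_cases h1 : 0 + c + 1 < m
        · have h2 : ¬ 0 + c + 1 = m := by omega
          simp only [if_pos h1, if_neg h2, splitWord, map_neg, hMap_word, hWord_cons]
          simp
        · have h2 : 0 + c + 1 = m := by omega
          have h3 : m - 1 = c := by omega
          rw [zero_add] at h1 h2
          rw [h3] at hdd IH' ⊢
          simp only [if_neg h1, if_pos h2, splitWord, if_true, zero_add, hdd, neg_zero, map_zero,
            zero_sub, sub_neg_eq_add, IH']
      | succ a =>
        rw [hWord_cons, ht, hd, hp, map_sub, hMap_consMap_succ, htail]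
        have hd' : dMap m (splitWord (e, a + 1) ((e, c) :: s)) =
            word ((e, a + 1) :: (e, c) :: s) -
              (if a + c + 1 < m then word ((e, 0) :: (e, a + c + 1) :: s) else 0)
              - consMap (e, 0) (consMap (e, a) (dWord m ((e, c) :: s))) := by
          simp only [splitWord, Nat.succ_ne_zero, if_false, map_neg, Nat.add_sub_cancel, dMap_word]
          rw [dWord, dWord]
          simp only [mergeWord]
          by_cases h1 : a + c + 1 < m <;> simp [ha, h1] <;> abel
        rw [map_add, hd']
        -- In the middle case the total length is `m + 1`: the head does not merge, but after the
        -- split its remainder merges with the second step to length `m`. The leftover block `1, m`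
        -- before `s` is resolved by the induction hypothesis.
        rcases lt_trichotomy (a + 1 + c + 1) m with h1 | h1 | h1
        · simp only [if_pos h1, if_neg h1.ne, if_pos (show a + c + 1 < m by omega), map_neg,
            hMap_word, hWord_cons]
          simp only [splitWord, Nat.succ_ne_zero, if_false, Nat.add_sub_cancel,
            show a + 1 + c = a + c + 1 by omega, map_zero]
          abel
        · have h2 : a + c + 1 = m - 1 := by omega
          simp only [if_neg h1.not_lt, if_pos h1, if_pos (show a + c + 1 < m by omega), hdd,
            neg_zero, map_zero]
          rw [h2, eq_sub_of_add_eq' IH']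
          abel
        · simp only [if_neg h1.not_gt, if_neg h1.ne', if_neg (show ¬ a + c + 1 < m by omega),
            neg_zero, map_zero]
          abel
    · have IH := dMap_hWord_add_hMap_dWord m ((f, c) :: s) fun t ht => h t (by
        simp only [List.mem_cons] at ht ⊢; tauto)
      have hp : pWord m ((e, a) :: (f, c) :: s) =
        if a = 0 then consMap (e, 0) (pWord m ((f, c) :: s)) else 0 := by
          simp [pWord, hef]
      have ht : tailWord m (e, a) ((f, c) :: s) =
        if a = 0 then -consMap (e, 0) (hWord m ((f, c) :: s)) else 0 := by
          simp [tailWord, hef]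
      have hd : dWord m ((e, a) :: (f, c) :: s) = -consMap (e, a) (dWord m ((f, c) :: s)) := by
        conv_lhs => rw [dWord]
        simp [mergeWord, hef]
      have htail : tailMap m (e, a) (dWord m ((f, c) :: s)) =
          if a = 0 then -consMap (e, 0) (hMap m (dWord m ((f, c) :: s))) else 0 := by
        conv_lhs => rw [dWord]
        rw [map_sub, map_neg, tailMap_mergeWord_ne m hef, tailMap_consMap_ne m hef]
        split_ifs
        · simp only [dWord, map_sub, map_neg]; abel
        · simp
      -- A unit step before a turn is passed over with a sign; a longer one is contracted by the
      -- split.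
      cases a with
      | zero =>
        rw [hWord_cons, ht, hd, hp, map_neg, hMap_consMap_zero, htail]
        have IH' := congrArg (consMap (e, 0)) IH
        simp only [map_add, map_sub, consMap_word] at IH'
        simp only [splitWord, if_true, zero_add, map_neg, neg_neg, dMap_consMap,
          mergeMap_hWord_ne m hef]
        rw [← IH']
        abel
      | succ a =>
        rw [hWord_cons, ht, hd, hp, map_neg, hMap_consMap_succ, htail]
        simp only [splitWord, Nat.succ_ne_zero, if_false, ← consMap_word, map_neg, map_add,
          dMap_consMap, mergeMap_consMap]
        simp [hef, dWord, mergeWord, ha]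
        abel

/-! ### Critical words -/

/-- The words which represent a basis of the homology: concatenations of single unit steps, each but
the last followed by a step in the other direction, and of pairs of steps of lengths `1` and `m`
in the same direction. -/
inductive IsCritical (m : ℕ) : List Step → Prop
  | nil : IsCritical m []
  | single (e : Bool) : IsCritical m [(e, 0)]
  | pair (e : Bool) {s : List Step} : IsCritical m s → IsCritical m ((e, 0) :: (e, m - 1) :: s)
  | turn {e f : Bool} {c : ℕ} {s : List Step} : e ≠ f → IsCritical m ((f, c) :: s) →
      IsCritical m ((e, 0) :: (f, c) :: s)

/-- No two neighbours merge: a block has total length `m + 1`, its second step is too long to absorb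
anything, and a lone unit step is followed by a turn. -/
theorem dWord_eq_zero_of_isCritical {m : ℕ} {s : List Step} (hs : IsCritical m s) :
    dWord m s = 0 := by
  induction hs with
  | nil => rfl
  | single e => simp [dWord, mergeWord]
  | @pair e s _ ih =>
    have h1 : mergeWord m (e, m - 1) s = 0 := by
      rw [← mergeMap_word, mergeMap_of_le (by simp only; omega)]
    rw [dWord, dWord, ih, h1, mergeWord, if_neg (by simp only; omega)]
    simp
  | turn hef _ ih => rw [dWord, ih]; simp [mergeWord, hef]

theorem pWord_of_isCritical {m : ℕ} (hm : 0 < m) {s : List Step} (hs : IsCritical m s) :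
    pWord m s = word s := by
  induction hs with
  | nil => rfl
  | single e => simp [pWord]
  | pair e _ ih => simp [pWord, ih, Nat.sub_add_cancel hm]
  | turn hef _ ih => simp [pWord, hef, ih]

theorem consMap_mem_supported {S T : Set (List Step)} {t : Step} (h : ∀ s ∈ S, t :: s ∈ T)
    {z : Words} (hz : z ∈ Finsupp.supported ℤ ℤ S) :
    consMap t z ∈ Finsupp.supported ℤ ℤ T := by
  rw [Finsupp.supported_eq_span_single] at hz
  induction hz using Submodule.span_induction with
  | mem x hx =>
    obtain ⟨s, hs, rfl⟩ := hx
    rw [consMap_word]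
    exact Finsupp.single_mem_supported ℤ _ (h s hs)
  | zero => simp
  | add x y _ _ hx hy => rw [map_add]; exact add_mem hx hy
  | smul a x _ hx => rw [map_smul]; exact Submodule.smul_mem _ a hx

/-- The initial direction is tracked because `IsCritical.turn` compares it with the preceding step.
-/
theorem pWord_mem_supported_isCritical (m : ℕ) :
    ∀ s, pWord m s ∈ Finsupp.supported ℤ ℤ
      {r | IsCritical m r ∧ r.head?.map Prod.fst = s.head?.map Prod.fst}
  | [] => Finsupp.single_mem_supported ℤ _ ⟨.nil, rfl⟩
  | [(e, a)] => by
    simp only [pWord]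
    split_ifs with h
    · subst h
      exact Finsupp.single_mem_supported ℤ _ ⟨.single e, rfl⟩
    · exact zero_mem _
  | (e, a) :: (f, c) :: s => by
    simp only [pWord]
    split_ifs with h1 h2 h2
    · exact consMap_mem_supported (fun _ hr => hr) (consMap_mem_supported
        (T := {r | IsCritical m ((e, 0) :: r) ∧ _}) (fun r hr => ⟨.pair e hr.1, rfl⟩)
        (pWord_mem_supported_isCritical m s))
    · exact zero_mem _
    · refine consMap_mem_supported (fun r hr => ?_)
        (pWord_mem_supported_isCritical m ((f, c) :: s))
      rcases r with _ | ⟨⟨f', b⟩, r⟩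
      · simp at hr
      · obtain ⟨hr, hf⟩ := hr
        obtain rfl : f' = f := by simpa using hf
        exact ⟨.turn h1 hr, rfl⟩
    · exact zero_mem _

/-! ### Grading by number of steps and total length -/

/-- The words of `k` steps of lengths at most `m` and of total length `l`. -/
def graded (m : ℕ) (k l : ℤ) : Set (List Step) :=
  {s | (∀ t ∈ s, t.2 < m) ∧ (s.length : ℤ) = k ∧ (((s.map fun t => t.2 + 1).sum : ℕ) : ℤ) = l}

/-- The span of the words in `graded m k l`. -/
noncomputable abbrev gradedSpan (m : ℕ) (k l : ℤ) : Submodule ℤ Words :=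
  Finsupp.supported ℤ ℤ (graded m k l)

theorem cons_mem_graded_iff {m : ℕ} {k l : ℤ} {t : Step} {s : List Step} :
    t :: s ∈ graded m k l ↔ t.2 < m ∧ s ∈ graded m (k - 1) (l - (t.2 + 1)) := by
  simp only [graded, Set.mem_ofPred_eq, List.forall_mem_cons, List.length_cons, List.map_cons,
    List.sum_cons]
  push_cast
  constructor
  · rintro ⟨⟨h1, h2⟩, h3, h4⟩
    exact ⟨h1, h2, by omega, by omega⟩
  · rintro ⟨h1, h2, h3, h4⟩
    exact ⟨⟨h1, h2⟩, by omega, by omega⟩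

theorem consMap_mem_gradedSpan {m : ℕ} {k l k' l' : ℤ} {t : Step} {z : Words}
    (hz : z ∈ gradedSpan m k' l') (ht : t.2 < m) (hk : k' = k - 1) (hl : l' = l - (t.2 + 1)) :
    consMap t z ∈ gradedSpan m k l := by
  subst hk hl
  exact consMap_mem_supported (fun s hs => cons_mem_graded_iff.2 ⟨ht, hs⟩) hz

theorem word_mem_gradedSpan {m : ℕ} {k l : ℤ} {s : List Step} (hs : s ∈ graded m k l) :
    word s ∈ gradedSpan m k l :=
  Finsupp.single_mem_supported ℤ _ hs

theorem mergeWord_mem_gradedSpan {m : ℕ} {k l : ℤ} {t : Step} {s : List Step}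
    (hs : t :: s ∈ graded m k l) : mergeWord m t s ∈ gradedSpan m (k - 1) l := by
  rcases s with _ | ⟨u, s⟩
  · exact zero_mem _
  simp only [cons_mem_graded_iff] at hs
  rw [mergeWord]
  split_ifs with h
  · refine word_mem_gradedSpan (cons_mem_graded_iff.2 ⟨h.2, ?_⟩)
    convert hs.2.2 using 2
    push_cast
    ring
  · exact zero_mem _

theorem dWord_mem_gradedSpan {m : ℕ} {k l : ℤ} {s : List Step} (hs : s ∈ graded m k l) :
    dWord m s ∈ gradedSpan m (k - 1) l := by
  induction s generalizing k l with
  | nil => exact zero_mem _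
  | cons t s ih =>
    have h := cons_mem_graded_iff.1 hs
    exact sub_mem (neg_mem (mergeWord_mem_gradedSpan hs))
      (consMap_mem_gradedSpan (ih h.2) h.1 rfl rfl)

theorem splitWord_mem_gradedSpan {m : ℕ} {k l : ℤ} {t : Step} {s : List Step}
    (hs : t :: s ∈ graded m k l) : splitWord t s ∈ gradedSpan m (k + 1) l := by
  rw [cons_mem_graded_iff] at hs
  rw [splitWord]
  split_ifs with h
  · exact zero_mem _
  · refine neg_mem (word_mem_gradedSpan ?_)
    rw [cons_mem_graded_iff, cons_mem_graded_iff]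
    refine ⟨by simp only; omega, by simp only; omega, ?_⟩
    convert hs.2 using 2
    · ring
    · simp only
      omega

theorem hWord_mem_gradedSpan {m : ℕ} :
    ∀ {k l : ℤ} {s : List Step}, s ∈ graded m k l → hWord m s ∈ gradedSpan m (k + 1) l
  | _, _, [], _ => zero_mem _
  | _, _, [_], hs => splitWord_mem_gradedSpan hs
  | k, l, (e, a) :: (f, c) :: s, hs => by
    rw [hWord]
    refine add_mem (splitWord_mem_gradedSpan hs) ?_
    have h := hs
    simp only [cons_mem_graded_iff] at h
    split_ifs with h1 h2 h2
    · simp only at h2 h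
      exact consMap_mem_gradedSpan (k' := k) (l' := l - 1)
        (consMap_mem_gradedSpan (hWord_mem_gradedSpan h.2.2) (by simp only; omega) (by ring) (by simp only; omega))
        (by simp only; omega) (by ring) (by simp)
    · exact zero_mem _
    · simp only at h2 h
      refine neg_mem (consMap_mem_gradedSpan (hWord_mem_gradedSpan (cons_mem_graded_iff.1 hs).2)
        (by simp only; omega) (by ring) ?_)
      simp [h2]
    · exact zero_mem _

theorem pWord_mem_gradedSpan {m : ℕ} :
    ∀ {k l : ℤ} {s : List Step}, s ∈ graded m k l → pWord m s ∈ gradedSpan m k l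
  | _, _, [], hs => word_mem_gradedSpan hs
  | _, _, [_], hs => by
    rw [pWord]
    split_ifs
    · exact word_mem_gradedSpan hs
    · exact zero_mem _
  | k, l, (e, a) :: (f, c) :: s, hs => by
    rw [pWord]
    have h := hs
    simp only [cons_mem_graded_iff] at h
    split_ifs with h1 h2 h2
    · simp only at h2 h
      exact consMap_mem_gradedSpan (k' := k - 1) (l' := l - 1)
        (consMap_mem_gradedSpan (pWord_mem_gradedSpan h.2.2) (by simp only; omega) (by ring) (by simp only; omega))
        (by simp only; omega) (by ring) (by simp)
    · exact zero_mem _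
    · simp only at h2 h
      refine consMap_mem_gradedSpan (pWord_mem_gradedSpan (cons_mem_graded_iff.1 hs).2)
        (by simp only; omega) (by ring) ?_
      simp [h2]
    · exact zero_mem _

/-- Linear maps agree on the span of words on which they agree. -/
theorem eq_of_mem_gradedSpan {M : Type*} [AddCommGroup M] {f g : Words →ₗ[ℤ] M} {m : ℕ} {k l : ℤ}
    (h : ∀ s ∈ graded m k l, f (word s) = g (word s)) {z : Words} (hz : z ∈ gradedSpan m k l) :
    f z = g z := by
  rw [gradedSpan, Finsupp.supported_eq_span_single] at hz
  refine LinearMap.eqOn_span (f := f) (g := g) ?_ hz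
  rintro _ ⟨s, hs, rfl⟩
  exact h s hs

end Words

/-! ### Sequences of vertices of an odd cycle -/

/-- The cycle on `2 * m + 1` vertices, with vertices in `ZMod (2 * m + 1)`. -/
abbrev oddCycle (m : ℕ) : SimpleGraph (ZMod (2 * m + 1)) := SimpleGraph.cycleGraph (2 * m + 1)

theorem oddCycle_connected (m : ℕ) : (oddCycle m).Connected := SimpleGraph.cycleGraph_connected

theorem oddCycle_adj {m : ℕ} (hm : 0 < m) {u v : ZMod (2 * m + 1)} :
    (oddCycle m).Adj u v ↔ u - v = 1 ∨ v - u = 1 := by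
  obtain ⟨n, rfl⟩ : ∃ n, m = n + 1 := ⟨m - 1, by omega⟩
  exact SimpleGraph.cycleGraph_adj (n := 2 * n + 1)

/-- Lifting a walk to `ℤ` bounds distances from below. -/
theorem exists_int_of_walk {m : ℕ} (hm : 0 < m) {u v : ZMod (2 * m + 1)}
    (p : (oddCycle m).Walk u v) : ∃ z : ℤ, z.natAbs ≤ p.length ∧ v = u + z := by
  induction p with
  | nil => exact ⟨0, by simp⟩
  | @cons u w v h p ih =>
    obtain ⟨z, hz, rfl⟩ := ih
    rcases (oddCycle_adj hm).1 h with h | h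
    · refine ⟨z - 1, by rw [SimpleGraph.Walk.length_cons]; omega, ?_⟩
      rw [sub_eq_iff_eq_add] at h
      rw [h]; push_cast; ring
    · refine ⟨z + 1, by rw [SimpleGraph.Walk.length_cons]; omega, ?_⟩
      rw [sub_eq_iff_eq_add] at h
      rw [h]; push_cast; ring

theorem oddCycle_dist_add_le {m : ℕ} (hm : 0 < m) (u : ZMod (2 * m + 1)) (n : ℕ) :
    (oddCycle m).dist u (u + n) ≤ n := by
  induction n with
  | zero => simp
  | succ n ih =>
    have h := (oddCycle_connected m).dist_triangle (u := u) (v := u + n) (w := u + (n + 1 : ℕ))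
    have h1 : (oddCycle m).dist (u + n) (u + (n + 1 : ℕ)) = 1 :=
      SimpleGraph.dist_eq_one_iff_adj.2 ((oddCycle_adj hm).2 (Or.inr (by push_cast; ring)))
    omega

theorem oddCycle_dist_add {m : ℕ} (hm : 0 < m) (u : ZMod (2 * m + 1)) {z : ℤ} (hz : z.natAbs ≤ m) :
    (oddCycle m).dist u (u + z) = z.natAbs := by
  apply le_antisymm
  · obtain h | h := z.natAbs_eq
    · generalize z.natAbs = n at h
      subst h
      exact_mod_cast oddCycle_dist_add_le hm u n
    · generalize z.natAbs = n at h
      subst h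
      rw [SimpleGraph.dist_comm]
      simpa using oddCycle_dist_add_le hm (u + ((-n : ℤ) : ZMod (2 * m + 1))) n
  · obtain ⟨p, hp⟩ := (oddCycle_connected m).exists_walk_length_eq_dist u (u + z)
    obtain ⟨z', hz', h⟩ := exists_int_of_walk hm p
    rw [← hp]
    by_contra! hlt
    have h1 : ((z - z' : ℤ) : ZMod (2 * m + 1)) = 0 := by
      push_cast
      rw [add_left_cancel h, sub_self]
    -- Congruent integers of absolute value at most `m` differ by less than the modulus, so they are
    -- equal.
    have h2 := Int.eq_zero_of_abs_lt_dvd ((ZMod.intCast_zmod_eq_zero_iff_dvd _ _).1 h1)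
      (by rw [abs_lt]; push_cast; omega)
    omega

/-- The displacement of a step. -/
def Step.toInt (t : Step) : ℤ := if t.1 then t.2 + 1 else -(t.2 + 1)

theorem Step.natAbs_toInt (t : Step) : t.toInt.natAbs = t.2 + 1 := by
  unfold Step.toInt; split_ifs <;> omega

theorem Step.toInt_add (e : Bool) (a c : ℕ) :
    Step.toInt (e, a + c + 1) = Step.toInt (e, a) + Step.toInt (e, c) := by
  simp only [Step.toInt]; split_ifs <;> push_cast <;> ring

/-- The step with a given displacement. -/
def stepOf (z : ℤ) : Step := (decide (0 ≤ z), z.natAbs - 1)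

theorem stepOf_toInt (t : Step) : stepOf t.toInt = t := by
  obtain ⟨e, a⟩ := t
  cases e <;> simp [stepOf, Step.toInt] <;> omega

theorem toInt_stepOf {z : ℤ} (hz : z ≠ 0) : (stepOf z).toInt = z := by
  simp only [stepOf, Step.toInt, decide_eq_true_eq]
  split_ifs <;> omega

/-- The sequence of vertices with given start and given steps. -/
def path (m : ℕ) (v : ZMod (2 * m + 1)) : List Step → List (ZMod (2 * m + 1))
  | [] => [v]
  | t :: s => v :: path m (v + t.toInt) s

/-- The steps of a sequence of vertices. -/
def steps (m : ℕ) : List (ZMod (2 * m + 1)) → List Step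
  | [] => []
  | [_] => []
  | a :: b :: x => stepOf (b - a).valMinAbs :: steps m (b :: x)

theorem path_eq_cons (m : ℕ) (v : ZMod (2 * m + 1)) (s : List Step) :
    ∃ x, path m v s = v :: x := by
  cases s <;> exact ⟨_, rfl⟩

theorem length_path (m : ℕ) (v : ZMod (2 * m + 1)) (s : List Step) :
    (path m v s).length = s.length + 1 := by
  induction s generalizing v with
  | nil => rfl
  | cons t s ih => simp [path, ih]

/-- The modulus being odd, the integers from `-m` to `m` are exactly the minimal residues, without
ties. -/
theorem valMinAbs_toInt {m : ℕ} {t : Step} (ht : t.2 < m) :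
    (t.toInt : ZMod (2 * m + 1)).valMinAbs = t.toInt := by
  rw [ZMod.valMinAbs_spec]
  have := t.natAbs_toInt
  refine ⟨rfl, ?_, ?_⟩ <;> push_cast <;> omega

theorem steps_path {m : ℕ} (v : ZMod (2 * m + 1)) {s : List Step} (hs : ∀ t ∈ s, t.2 < m) :
    steps m (path m v s) = s := by
  induction s generalizing v with
  | nil => rfl
  | cons t s ih =>
    obtain ⟨x, hx⟩ := path_eq_cons m (v + t.toInt) s
    have := ih (v + t.toInt) fun u hu => hs u (by simp [hu])
    rw [path, hx, steps, ← hx, this, add_sub_cancel_left, valMinAbs_toInt (hs t (by simp)),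
      stepOf_toInt]

theorem pathLength_path {m : ℕ} (v : ZMod (2 * m + 1)) {s : List Step} (hs : ∀ t ∈ s, t.2 < m) :
    pathLength (oddCycle m) (path m v s) = (s.map fun t => t.2 + 1).sum := by
  induction s generalizing v with
  | nil => rfl
  | cons t s ih =>
    obtain ⟨x, hx⟩ := path_eq_cons m (v + t.toInt) s
    have := ih (v + t.toInt) fun u hu => hs u (by simp [hu])
    have ht := hs t (by simp)
    have h1 := t.natAbs_toInt
    rw [path, hx, pathLength, ← hx, this, oddCycle_dist_add (by omega) v (by omega), h1,
      List.map_cons, List.sum_cons]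

theorem isChain_path {m : ℕ} (v : ZMod (2 * m + 1)) {s : List Step} (hs : ∀ t ∈ s, t.2 < m) :
    (path m v s).IsChain (· ≠ ·) := by
  induction s generalizing v with
  | nil => exact .singleton v
  | cons t s ih =>
    obtain ⟨x, hx⟩ := path_eq_cons m (v + t.toInt) s
    have := ih (v + t.toInt) fun u hu => hs u (by simp [hu])
    rw [path, hx, List.isChain_cons_cons, ← hx]
    refine ⟨fun h => ?_, this⟩
    have h1 := valMinAbs_toInt (hs t (by simp))
    rw [left_eq_add.1 h, ZMod.valMinAbs_zero] at h1
    have := t.natAbs_toInt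
    omega

theorem isGenerator_path {m : ℕ} {k l : ℤ} (v : ZMod (2 * m + 1)) {s : List Step}
    (hs : s ∈ Words.graded m k l) : IsGenerator (oddCycle m) k l (path m v s) where
  ne_nil := by obtain ⟨x, hx⟩ := path_eq_cons m v s; simp [hx]
  length_eq := by rw [length_path, ← hs.2.1]; push_cast; rfl
  isChain := isChain_path v hs.1
  pathLength_eq := by rw [pathLength_path v hs.1, hs.2.2]

/-- Consecutive vertices have to differ, as `stepOf 0` has displacement `1`. -/
theorem path_steps {m : ℕ} (v : ZMod (2 * m + 1)) {x : List (ZMod (2 * m + 1))}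
    (hx : (v :: x).IsChain (· ≠ ·)) : path m v (steps m (v :: x)) = v :: x := by
  induction x generalizing v with
  | nil => rfl
  | cons w x ih =>
    rw [List.isChain_cons_cons] at hx
    rw [steps, path, toInt_stepOf, ZMod.coe_valMinAbs, add_sub_cancel, ih w hx.2]
    rw [ne_eq, ZMod.valMinAbs_eq_zero, sub_eq_zero]
    exact hx.1.symm

theorem lt_of_mem_steps {m : ℕ} (hm : 0 < m) {x : List (ZMod (2 * m + 1))} :
    ∀ t ∈ steps m x, t.2 < m := by
  induction x with
  | nil => simp [steps]
  | cons v x ih =>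
    rcases x with _ | ⟨w, x⟩
    · simp [steps]
    · rw [steps, List.forall_mem_cons]
      refine ⟨?_, ih⟩
      have := ZMod.natAbs_valMinAbs_le (w - v)
      simp only [stepOf]
      omega

theorem steps_mem_graded {m : ℕ} (hm : 0 < m) {k l : ℤ} {x : List (ZMod (2 * m + 1))}
    (hx : IsGenerator (oddCycle m) k l x) : steps m x ∈ Words.graded m k l := by
  rcases x with _ | ⟨v, x⟩
  · exact absurd rfl hx.ne_nil
  have h := path_steps v hx.isChain
  have h1 := lt_of_mem_steps hm (x := v :: x)
  refine ⟨h1, ?_, ?_⟩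
  · have h2 := length_path m v (steps m (v :: x))
    rw [h] at h2
    have := hx.length_eq
    omega
  · rw [← pathLength_path v h1, h, hx.pathLength_eq]

/-- Generators of the magnitude chain group are given by their starting vertices and steps. -/
def generatorEquiv {m : ℕ} (hm : 0 < m) (k l : ℤ) :
    {x // IsGenerator (oddCycle m) k l x} ≃ ZMod (2 * m + 1) × Words.graded m k l where
  toFun x := (x.1.head x.2.ne_nil, ⟨steps m x.1, steps_mem_graded hm x.2⟩)
  invFun p := ⟨path m p.1 p.2.1, isGenerator_path p.1 p.2.2⟩
  left_inv := by
    rintro ⟨_ | ⟨v, x⟩, hx⟩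
    · exact absurd rfl hx.ne_nil
    · exact Subtype.ext (path_steps v hx.isChain)
  right_inv := by
    rintro ⟨v, s, hs⟩
    refine Prod.ext ?_ (Subtype.ext (steps_path v hs.1))
    obtain ⟨x, hx⟩ := path_eq_cons m v s
    simp [hx]

open Words

/-! ### The differential in terms of steps -/

/-- The sum in the definition of the differential, with an arbitrary function in place of
`ofSeq`. -/
theorem sum_eraseIdx_cons {V M : Type*} [AddCommGroup M] (φ : List V → M) (a b c : V)
    (x : List V) :
    ∑ i ∈ Finset.Ioo 0 ((a :: b :: c :: x).length - 1),
        (-1 : ℤ) ^ i • φ ((a :: b :: c :: x).eraseIdx i) =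
      -φ (a :: c :: x) - ∑ i ∈ Finset.Ioo 0 ((b :: c :: x).length - 1),
        (-1 : ℤ) ^ i • φ (a :: (b :: c :: x).eraseIdx i) := by
  have key : ∀ (n : ℕ) (f : ℕ → M),
      ∑ i ∈ Finset.Ioo 0 n, f i = ∑ i ∈ Finset.range (n - 1), f (i + 1) := by
    intro n f
    rw [← Finset.Ico_add_one_left_eq_Ioo, Finset.sum_Ico_eq_sum_range]
    exact Finset.sum_congr rfl fun i _ => by rw [zero_add, add_comm]
  rw [key, key]
  simp only [List.length_cons, Nat.add_sub_cancel]
  rw [Finset.sum_range_succ', sub_eq_add_neg, add_comm, ← Finset.sum_neg_distrib]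
  congr 1
  · simp
  · refine Finset.sum_congr rfl fun i _ => ?_
    rw [List.eraseIdx_cons_succ, pow_succ, mul_neg_one, neg_smul]

theorem pathLength_append_cons {V : Type*} (G : SimpleGraph V) (q : List V) (a : V) (x : List V) :
    pathLength G (q ++ a :: x) = pathLength G (q ++ [a]) + pathLength G (a :: x) := by
  induction q with
  | nil => simp [pathLength]
  | cons b q ih =>
    rcases q with _ | ⟨c, q⟩
    · simp [pathLength]
    · simp only [List.cons_append, pathLength] at ih ⊢
      omega

/-- Opposite steps partly cancel. Steps in one direction of total length above `m` are beaten by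
going round the other way, which accounts for the witnesses shifted by `2 * m + 1`. -/
theorem oddCycle_dist_add_add_lt {m : ℕ} (v : ZMod (2 * m + 1)) {t u : Step} (ht : t.2 < m)
    (hu : u.2 < m) (h : ¬(t.1 = u.1 ∧ t.2 + u.2 + 1 < m)) :
    (oddCycle m).dist v (v + t.toInt + u.toInt) < t.2 + 1 + (u.2 + 1) := by
  suffices ∃ z : ℤ, z.natAbs ≤ m ∧ z.natAbs < t.2 + 1 + (u.2 + 1) ∧
      ((t.toInt + u.toInt : ℤ) : ZMod (2 * m + 1)) = z by
    obtain ⟨z, h1, h2, h3⟩ := this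
    rw [add_assoc, ← Int.cast_add, h3, oddCycle_dist_add (by omega) v h1]
    exact h2
  have key : ((2 * m + 1 : ℤ) : ZMod (2 * m + 1)) = 0 := by
    exact_mod_cast ZMod.natCast_self (2 * m + 1)
  obtain ⟨e, a⟩ := t
  obtain ⟨f, c⟩ := u
  simp only at ht hu h
  cases e <;> cases f <;> simp only [Step.toInt]
  · refine ⟨-(a + 1) + -(c + 1) + (2 * m + 1), ?_, ?_, ?_⟩
    · simp at h ⊢; omega
    · simp at h ⊢; omega
    · rw [Int.cast_add _ (2 * m + 1 : ℤ), key, add_zero]; simp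
  · refine ⟨-(a + 1) + (c + 1), ?_, ?_, ?_⟩
    · omega
    · omega
    · simp
  · refine ⟨(a + 1) + -(c + 1), ?_, ?_, ?_⟩
    · omega
    · omega
    · simp
  · refine ⟨(a + 1) + (c + 1) - (2 * m + 1), ?_, ?_, ?_⟩
    · simp at h ⊢; omega
    · simp at h ⊢; omega
    · rw [Int.cast_sub _ (2 * m + 1 : ℤ), key, sub_zero]; simp

/-- Merging steps of a path corresponds to omitting a vertex. -/
theorem sum_ofSeq_eraseIdx_path {m : ℕ} (hm : 0 < m) (j l : ℤ) (q : List (ZMod (2 * m + 1)))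
    (v : ZMod (2 * m + 1)) {s : List Step} (hs : ∀ t ∈ s, t.2 < m)
    (hl : (pathLength (oddCycle m) (q ++ path m v s) : ℤ) = l) :
    ∑ i ∈ Finset.Ioo 0 ((path m v s).length - 1),
        (-1 : ℤ) ^ i • ofSeq (oddCycle m) j l (q ++ (path m v s).eraseIdx i) =
      extend (fun r => ofSeq (oddCycle m) j l (q ++ path m v r)) (dWord m s) := by
  induction s generalizing q v with
  | nil => simp [path, dWord]
  | cons t s ih =>
    rcases s with _ | ⟨u, s⟩
    · have : Finset.Ioo 0 1 = (∅ : Finset ℕ) := rfl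
      simp [path, dWord, mergeWord, this]
    obtain ⟨x, hx⟩ := path_eq_cons m (v + t.toInt + u.toInt) s
    have hp : path m (v + t.toInt) (u :: s) = (v + t.toInt) :: path m (v + t.toInt + u.toInt) s :=
      rfl
    -- The vertex stripped off moves into the prefix `q`, because `ofSeq` tests the length of the
    -- whole sequence.
    have ih' := ih (q ++ [v]) (v + t.toInt) (fun r hr => hs r (List.mem_cons_of_mem _ hr))
      (by simpa [path] using hl)
    simp only [List.append_assoc, List.singleton_append] at ih'
    have hcons : ∀ z, extend (fun r => ofSeq (oddCycle m) j l (q ++ path m v r)) (consMap t z) =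
        extend (fun r => ofSeq (oddCycle m) j l (q ++ v :: path m (v + t.toInt) r)) z := by
      intro z
      rw [← LinearMap.comp_apply]
      congr 1
      exact hom_ext fun r => by
        rw [LinearMap.comp_apply, consMap_word, extend_word, extend_word]; rfl
    rw [dWord, map_sub, map_neg, hcons, ← ih', path, hp, hx,
      sum_eraseIdx_cons fun y => ofSeq (oddCycle m) j l (q ++ y)]
    congr 2
    obtain ⟨e, a⟩ := t
    obtain ⟨f, c⟩ := u
    simp only [mergeWord]
    split_ifs with h
    · obtain ⟨rfl, h⟩ := h
      rw [extend_word, path, Step.toInt_add]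
      push_cast
      rw [← add_assoc, hx]
    -- Omitting the vertex strictly shortens the sequence, so the face is not a generator of length
    -- `l`.
    · rw [map_zero, ofSeq, dif_neg]
      intro hg
      have h1 := hg.pathLength_eq
      have h2 := oddCycle_dist_add_add_lt v (hs (e, a) (by simp)) (hs (f, c) (by simp)) h
      have h3 := oddCycle_dist_add (u := v) hm (z := Step.toInt (e, a))
        (by rw [Step.natAbs_toInt]; exact hs (e, a) (by simp))
      have h4 := oddCycle_dist_add (u := v + Step.toInt (e, a)) hm (z := Step.toInt (f, c))
        (by rw [Step.natAbs_toInt]; exact hs (f, c) (by simp))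
      rw [path, hp, hx, pathLength_append_cons, pathLength, pathLength, h3, h4,
        Step.natAbs_toInt, Step.natAbs_toInt] at hl
      rw [pathLength_append_cons, pathLength] at h1
      simp only at hl h2
      omega

/-! ### The homotopy on magnitude chains -/

/-- A chain homotopy between the identity and a projection to a submodule of cycles identifies the
homology with this submodule. -/
theorem nonempty_homology_equiv {A B C : Type*} [AddCommGroup A] [AddCommGroup B] [AddCommGroup C]
    (d₁ : A →ₗ[ℤ] B) (d₀ : B →ₗ[ℤ] C) (h₁ : B →ₗ[ℤ] A) (h₀ : C →ₗ[ℤ] B) (p : B →ₗ[ℤ] B)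
    (Q : Submodule ℤ B) (hh : ∀ b, d₁ (h₁ b) + h₀ (d₀ b) = b - p b) (hp : ∀ b, p b ∈ Q)
    (hpQ : ∀ b ∈ Q, p b = b) (hdQ : ∀ b ∈ Q, d₀ b = 0) (hpd : ∀ a, p (d₁ a) = 0) :
    Nonempty ((LinearMap.ker d₀ ⧸ (LinearMap.range d₁).submoduleOf (LinearMap.ker d₀)) ≃ₗ[ℤ] Q) := by
  -- On cycles the homotopy reads `d₁ (h₁ b) = b - p b`, so a cycle killed by `p` is a boundary.
  let f : LinearMap.ker d₀ →ₗ[ℤ] Q := (p.codRestrict Q hp).comp (LinearMap.ker d₀).subtype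
  have hf : Function.Surjective f := fun q => ⟨⟨q, hdQ q q.2⟩, Subtype.ext (hpQ q q.2)⟩
  have hker : (LinearMap.range d₁).submoduleOf (LinearMap.ker d₀) = LinearMap.ker f := by
    ext ⟨b, hb⟩
    rw [LinearMap.mem_ker] at hb
    rw [Submodule.submoduleOf, Submodule.mem_comap, LinearMap.mem_ker]
    constructor
    · rintro ⟨a, ha⟩
      exact Subtype.ext ((congrArg p ha).symm.trans (hpd a))
    · intro h
      have h1 : p b = 0 := congrArg Subtype.val h
      have h2 := hh b
      rw [hb, map_zero, add_zero, h1, sub_zero] at h2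
      exact ⟨_, h2⟩
  exact ⟨(Submodule.quotEquivOfEq _ _ hker).trans (f.quotKerEquivOfSurjective hf)⟩

/-- The magnitude chain with given start and given steps. -/
noncomputable def pathMap (m : ℕ) (k l : ℤ) (v : ZMod (2 * m + 1)) :
    Words →ₗ[ℤ] MC (oddCycle m) k l :=
  extend fun s => ofSeq (oddCycle m) k l (path m v s)

theorem pathMap_word {m : ℕ} {k l : ℤ} (v : ZMod (2 * m + 1)) {s : List Step}
    (hs : s ∈ graded m k l) :
    pathMap m k l v (word s) = Finsupp.single ⟨path m v s, isGenerator_path v hs⟩ 1 := by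
  rw [pathMap, extend_word, ofSeq, dif_pos]

theorem exists_single_eq_pathMap {m : ℕ} (hm : 0 < m) {k l : ℤ}
    (x : {x // IsGenerator (oddCycle m) k l x}) :
    ∃ v, Finsupp.single x (1 : ℤ) = pathMap m k l v (word (steps m x.1)) := by
  obtain ⟨⟨v, s⟩, rfl⟩ := (generatorEquiv hm k l).symm.surjective x
  refine ⟨v, ?_⟩
  have h : steps m ((generatorEquiv hm k l).symm (v, s)).1 = s.1 := steps_path v s.2.1
  rw [h, pathMap_word v s.2]
  rfl

theorem differential_pathMap {m : ℕ} (hm : 0 < m) (k j l : ℤ) (v : ZMod (2 * m + 1)) {z : Words}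
    (hz : z ∈ gradedSpan m k l) :
    differential (oddCycle m) k j l (pathMap m k l v z) = pathMap m j l v (dMap m z) := by
  refine eq_of_mem_gradedSpan (f := differential (oddCycle m) k j l ∘ₗ pathMap m k l v)
    (g := pathMap m j l v ∘ₗ dMap m) (fun s hs => ?_) hz
  rw [LinearMap.comp_apply, LinearMap.comp_apply, pathMap_word v hs, differential_single, dMap_word]
  exact sum_ofSeq_eraseIdx_path hm j l [] v hs.1 (isGenerator_path v hs).pathLength_eq

/-- The map on magnitude chains induced by a map on words. -/
noncomputable def chainMap (m : ℕ) (T : List Step → Words) (k k' l : ℤ) :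
    MC (oddCycle m) k l →ₗ[ℤ] MC (oddCycle m) k' l :=
  Finsupp.lift (MC (oddCycle m) k' l) ℤ _ fun x =>
    pathMap m k' l (x.1.head x.2.ne_nil) (T (steps m x.1))

/-- The restriction to `gradedSpan` is needed because `steps` recovers a word from its path only
when all steps have length at most `m`. -/
theorem chainMap_pathMap {m : ℕ} (T : List Step → Words) (k k' l : ℤ) (v : ZMod (2 * m + 1))
    {z : Words} (hz : z ∈ gradedSpan m k l) :
    chainMap m T k k' l (pathMap m k l v z) = pathMap m k' l v (extend T z) := by
  refine eq_of_mem_gradedSpan (f := chainMap m T k k' l ∘ₗ pathMap m k l v)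
    (g := pathMap m k' l v ∘ₗ extend T) (fun s hs => ?_) hz
  rw [LinearMap.comp_apply, LinearMap.comp_apply, pathMap_word v hs, extend_word]
  obtain ⟨x, hx⟩ := path_eq_cons m v s
  have h := steps_path v hs.1
  rw [hx] at h
  simp [chainMap, hx, h]

/-- Degrees are variables tied by equations so that the identity also applies in degree `k + 1`,
where `k + 1 - 1` would need a cast. -/
theorem chainMap_homotopy {m : ℕ} (hm : 0 < m) {k k' j : ℤ} (l : ℤ) (hk' : k' = k + 1)
    (hj : j = k - 1) (w : MC (oddCycle m) k l) :
    differential (oddCycle m) k' k l (chainMap m (hWord m) k k' l w) +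
        chainMap m (hWord m) j k l (differential (oddCycle m) k j l w) =
      w - chainMap m (pWord m) k k l w := by
  subst hk' hj
  suffices differential (oddCycle m) (k + 1) k l ∘ₗ chainMap m (hWord m) k (k + 1) l +
      chainMap m (hWord m) (k - 1) k l ∘ₗ differential (oddCycle m) k (k - 1) l =
      LinearMap.id - chainMap m (pWord m) k k l from LinearMap.congr_fun this w
  refine Finsupp.lhom_ext' fun x => LinearMap.ext_ring ?_
  have hs := steps_mem_graded hm x.2
  obtain ⟨v, hv⟩ := exists_single_eq_pathMap hm x
  simp only [LinearMap.comp_apply, LinearMap.add_apply, LinearMap.sub_apply, LinearMap.id_apply,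
    Finsupp.lsingle_apply, hv]
  have hw := word_mem_gradedSpan hs
  rw [chainMap_pathMap _ _ _ _ _ hw, chainMap_pathMap _ _ _ _ _ hw, differential_pathMap hm _ _ _ _ hw,
    extend_word, extend_word, dMap_word, chainMap_pathMap _ _ _ _ _ (dWord_mem_gradedSpan hs),
    differential_pathMap hm _ _ _ _ (hWord_mem_gradedSpan hs), ← map_sub, ← map_add]
  congr 1
  exact dMap_hWord_add_hMap_dWord m _ hs.1

/-- The span of the critical generators of the magnitude chain group. -/
noncomputable abbrev criticalSpan (m : ℕ) (k l : ℤ) : Submodule ℤ (MC (oddCycle m) k l) :=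
  Finsupp.supported ℤ ℤ {x | IsCritical m (steps m x.1)}

theorem chainMap_pWord_mem_criticalSpan {m : ℕ} (hm : 0 < m) (k l : ℤ)
    (w : MC (oddCycle m) k l) : chainMap m (pWord m) k k l w ∈ criticalSpan m k l := by
  induction w using Finsupp.induction_linear with
  | zero => simp
  | add f g hf hg => rw [map_add]; exact add_mem hf hg
  | single x a =>
    rw [← Finsupp.smul_single_one, map_smul]
    refine Submodule.smul_mem _ a ?_
    have hs := steps_mem_graded hm x.2
    obtain ⟨v, hv⟩ := exists_single_eq_pathMap hm x
    rw [hv, chainMap_pathMap _ _ _ _ _ (word_mem_gradedSpan hs), extend_word]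
    have h : pWord m (steps m x.1) ∈ Finsupp.supported ℤ ℤ (graded m k l ∩ {r | IsCritical m r}) := by
      rw [Finsupp.supported_inter]
      exact ⟨pWord_mem_gradedSpan hs, Finsupp.supported_mono (fun _ hr => hr.1)
        (pWord_mem_supported_isCritical m _)⟩
    rw [Finsupp.supported_eq_span_single] at h
    generalize pWord m (steps m x.1) = z at h
    induction h using Submodule.span_induction with
    | zero => simp
    | add y z _ _ hy hz => rw [map_add]; exact add_mem hy hz
    | smul b y _ hy => rw [map_smul]; exact Submodule.smul_mem _ b hy
    | mem y hy =>
      obtain ⟨r, hr, rfl⟩ := hy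
      rw [pathMap_word v hr.1]
      refine Finsupp.single_mem_supported ℤ _ ?_
      change IsCritical m (steps m (path m v r))
      rw [steps_path v hr.1.1]
      exact hr.2

theorem eqOn_criticalSpan {m : ℕ} (hm : 0 < m) {k l : ℤ} {M : Type*} [AddCommGroup M]
    {f g : MC (oddCycle m) k l →ₗ[ℤ] M}
    (h : ∀ v, ∀ s ∈ graded m k l, IsCritical m s →
      f (pathMap m k l v (word s)) = g (pathMap m k l v (word s))) :
    ∀ w ∈ criticalSpan m k l, f w = g w := by
  intro w hw
  rw [criticalSpan, Finsupp.supported_eq_span_single] at hw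
  refine LinearMap.eqOn_span (f := f) (g := g) ?_ hw
  rintro _ ⟨x, hx, rfl⟩
  obtain ⟨v, hv⟩ := exists_single_eq_pathMap hm x
  simp only [hv]
  exact h v _ (steps_mem_graded hm x.2) hx

theorem chainMap_pWord_of_mem_criticalSpan {m : ℕ} (hm : 0 < m) (k l : ℤ) :
    ∀ w ∈ criticalSpan m k l, chainMap m (pWord m) k k l w = w := by
  refine eqOn_criticalSpan (g := LinearMap.id) hm fun v s hs hc => ?_
  rw [chainMap_pathMap _ _ _ _ _ (word_mem_gradedSpan hs), extend_word, pWord_of_isCritical hm hc]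
  rfl

theorem differential_of_mem_criticalSpan {m : ℕ} (hm : 0 < m) (k j l : ℤ) :
    ∀ w ∈ criticalSpan m k l, differential (oddCycle m) k j l w = 0 := by
  refine eqOn_criticalSpan (g := 0) hm fun v s hs hc => ?_
  rw [differential_pathMap hm _ _ _ _ (word_mem_gradedSpan hs), dMap_word,
    dWord_eq_zero_of_isCritical hc]
  simp

theorem differential_differential {V : Type*} {G : SimpleGraph V} (hG : G.Connected) {k k' j : ℤ}
    (l : ℤ) (hk' : k' = k + 1) (hj : j = k - 1) (w : MC G k' l) :
    differential G k j l (differential G k' k l w) = 0 := by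
  subst hk' hj
  exact LinearMap.congr_fun (differential_comp_differential hG k l) w

/-- Compute `d h d w` twice: the homotopy identity at `d w` gives `d w - p (d w)`, and `d` applied
to the identity at `w` gives `d w`, since `d p = 0`. -/
theorem chainMap_pWord_differential {m : ℕ} (hm : 0 < m) (k l : ℤ)
    (w : MC (oddCycle m) (k + 1) l) :
    chainMap m (pWord m) k k l (differential (oddCycle m) (k + 1) k l w) = 0 := by
  have h1 := chainMap_homotopy hm l rfl rfl (differential (oddCycle m) (k + 1) k l w)
  rw [differential_differential (oddCycle_connected m) l rfl rfl, map_zero, add_zero] at h1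
  have h2 := congrArg (differential (oddCycle m) (k + 1) k l)
    (chainMap_homotopy hm l rfl (add_sub_cancel_right k 1).symm w)
  rw [map_add, map_sub, differential_differential (oddCycle_connected m) l rfl (by ring), zero_add,
    differential_of_mem_criticalSpan hm _ _ _ _ (chainMap_pWord_mem_criticalSpan hm _ _ w),
    sub_zero, h1] at h2
  simpa using h2

/-- Magnitude homology of an odd cycle is the free abelian group on the critical generators. -/
theorem nonempty_MH_equiv {m : ℕ} (hm : 0 < m) (k l : ℤ) :
    Nonempty (MH (oddCycle m) k l ≃ₗ[ℤ] criticalSpan m k l) :=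
  nonempty_homology_equiv _ _ (chainMap m (hWord m) k (k + 1) l)
    (chainMap m (hWord m) (k - 1) k l) (chainMap m (pWord m) k k l) _
    (chainMap_homotopy hm l rfl rfl) (chainMap_pWord_mem_criticalSpan hm k l)
    (chainMap_pWord_of_mem_criticalSpan hm k l) (differential_of_mem_criticalSpan hm k (k - 1) l)
    (chainMap_pWord_differential hm k l)

/-! ### Counting critical words -/

/-- The critical words with `k` steps, total length `l` and initial direction `e`. -/
def criticalFrom (m : ℕ) : ℕ → ℤ → Bool → Finset (List Step)
  -- The empty word has no initial direction; `critical` adds it separately.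
  | 0, _, _ => ∅
  | 1, l, e => if l = 1 then {[(e, 0)]} else ∅
  | k + 2, l, e =>
    (criticalFrom m (k + 1) (l - 1) (!e)).image (List.cons (e, 0)) ∪
      -- This is `critical m k (l - (m + 1))` spelled out, as `critical` is defined from the present
      -- function.
      ((if k = 0 ∧ l - (m + 1) = 0 then {[]} else ∅) ∪ criticalFrom m k (l - (m + 1)) true ∪
        criticalFrom m k (l - (m + 1)) false).image fun s => (e, 0) :: (e, m - 1) :: s

/-- The critical words with `k` steps and total length `l`. -/
def critical (m k : ℕ) (l : ℤ) : Finset (List Step) :=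
  (if k = 0 ∧ l = 0 then {[]} else ∅) ∪ criticalFrom m k l true ∪ criticalFrom m k l false

theorem criticalFrom_add_two (m k : ℕ) (l : ℤ) (e : Bool) :
    criticalFrom m (k + 2) l e =
      (criticalFrom m (k + 1) (l - 1) (!e)).image (List.cons (e, 0)) ∪
        (critical m k (l - (m + 1))).image fun s => (e, 0) :: (e, m - 1) :: s := rfl

theorem exists_eq_cons_of_mem_criticalFrom {m k : ℕ} {l : ℤ} {e : Bool} {s : List Step}
    (hs : s ∈ criticalFrom m k l e) : ∃ r, s = (e, 0) :: r := by
  match k with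
  | 0 => simp [criticalFrom] at hs
  | 1 =>
    rw [criticalFrom] at hs
    split_ifs at hs
    · exact ⟨[], by simpa using hs⟩
    · simp at hs
  | k + 2 =>
    rw [criticalFrom_add_two, Finset.mem_union, Finset.mem_image, Finset.mem_image] at hs
    obtain ⟨r, -, rfl⟩ | ⟨r, -, rfl⟩ := hs <;> exact ⟨_, rfl⟩

theorem isCritical_of_mem_criticalFrom {m : ℕ} (hm : 0 < m) (k : ℕ) {l : ℤ} {e : Bool}
    {s : List Step} (hs : s ∈ criticalFrom m k l e) : IsCritical m s ∧ s ∈ graded m k l := by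
  induction k using Nat.strong_induction_on generalizing l e s with
  | _ k ih =>
  match k with
  | 0 => simp [criticalFrom] at hs
  | 1 =>
    rw [criticalFrom] at hs
    split_ifs at hs with h
    · obtain rfl : s = [(e, 0)] := by simpa using hs
      exact ⟨.single e, by simp [graded, hm, h]⟩
    · simp at hs
  | k + 2 =>
    rw [criticalFrom_add_two, Finset.mem_union, Finset.mem_image, Finset.mem_image] at hs
    obtain ⟨r, hr, rfl⟩ | ⟨r, hr, rfl⟩ := hs
    · have h := ih (k + 1) (by omega) hr
      obtain ⟨r, rfl⟩ := exists_eq_cons_of_mem_criticalFrom hr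
      refine ⟨.turn (by simp) h.1, cons_mem_graded_iff.2 ⟨hm, ?_⟩⟩
      convert h.2 using 2
      · push_cast; ring
      · simp
    · have h : IsCritical m r ∧ r ∈ graded m k (l - (m + 1)) := by
        rw [critical, Finset.mem_union, Finset.mem_union] at hr
        obtain (hr | hr) | hr := hr
        · split_ifs at hr with h
          · obtain rfl : r = [] := by simpa using hr
            exact ⟨.nil, by simp [graded, h]⟩
          · simp at hr
        · exact ih k (by omega) hr
        · exact ih k (by omega) hr
      refine ⟨.pair e h.1, cons_mem_graded_iff.2 ⟨hm, cons_mem_graded_iff.2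
        ⟨by simp only; omega, ?_⟩⟩⟩
      convert h.2 using 2
      · push_cast; ring
      · simp only; omega

theorem mem_critical_of_mem_criticalFrom {m k : ℕ} {l : ℤ} {s : List Step}
    (h₀ : s = [] → k = 0 ∧ l = 0) (h : ∀ e a r, s = (e, a) :: r → s ∈ criticalFrom m k l e) :
    s ∈ critical m k l := by
  rw [critical, Finset.mem_union, Finset.mem_union]
  rcases s with _ | ⟨⟨_ | _, a⟩, r⟩
  · rw [if_pos (h₀ rfl)]
    simp
  · exact Or.inr (h _ _ _ rfl)
  · exact Or.inl (Or.inr (h _ _ _ rfl))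

theorem eq_zero_of_nil_mem_graded {m k : ℕ} {l : ℤ} (h : [] ∈ graded m k l) : k = 0 ∧ l = 0 := by
  have h1 := h.2.1
  have h2 := h.2.2
  simp only [List.length_nil, List.map_nil, List.sum_nil] at h1 h2
  omega

theorem mem_criticalFrom_of_isCritical {m : ℕ} (hm : 0 < m) {s : List Step}
    (hs : IsCritical m s) {k : ℕ} {l : ℤ} (h : s ∈ graded m k l) :
    ∀ e a r, s = (e, a) :: r → s ∈ criticalFrom m k l e := by
  induction hs generalizing k l with
  | nil => simp
  | single e =>
    rintro e' a r hr
    obtain ⟨⟨rfl, rfl⟩, rfl⟩ : (e = e' ∧ 0 = a) ∧ [] = r := by simpa using hr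
    obtain ⟨-, h1, h2⟩ := h
    obtain rfl : k = 1 := by simpa [eq_comm] using h1
    simp only [List.map_cons, List.map_nil, List.sum_cons, List.sum_nil] at h2
    rw [criticalFrom, if_pos (by omega)]
    simp
  | @pair e s hs ih =>
    rintro e' a r hr
    obtain ⟨⟨rfl, rfl⟩, rfl⟩ : (e = e' ∧ 0 = a) ∧ (e, m - 1) :: s = r := by simpa using hr
    obtain ⟨k, rfl⟩ : ∃ j, k = j + 2 :=
      ⟨k - 2, by have := h.2.1; simp only [List.length_cons] at this; omega⟩
    rw [cons_mem_graded_iff, cons_mem_graded_iff] at h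
    have h1 : s ∈ graded m k (l - (m + 1)) := by
      convert h.2.2 using 2
      · push_cast; ring
      · simp only; omega
    rw [criticalFrom_add_two, Finset.mem_union]
    refine Or.inr (Finset.mem_image_of_mem _ (mem_critical_of_mem_criticalFrom ?_ (ih h1)))
    rintro rfl
    exact eq_zero_of_nil_mem_graded h1
  | @turn e f c s hef hs ih =>
    rintro e' a r hr
    obtain ⟨⟨rfl, rfl⟩, rfl⟩ : (e = e' ∧ 0 = a) ∧ (f, c) :: s = r := by simpa using hr
    obtain ⟨k, rfl⟩ : ∃ j, k = j + 2 :=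
      ⟨k - 2, by have := h.2.1; simp only [List.length_cons] at this; omega⟩
    rw [cons_mem_graded_iff] at h
    have h1 : (f, c) :: s ∈ graded m (k + 1 : ℕ) (l - 1) := by
      convert h.2 using 2
      · push_cast; ring
      · simp
    obtain rfl : f = !e := by cases e <;> cases f <;> simp_all
    rw [criticalFrom_add_two, Finset.mem_union]
    exact Or.inl (Finset.mem_image_of_mem _ (ih h1 _ _ _ rfl))

theorem mem_critical_iff {m : ℕ} (hm : 0 < m) {k : ℕ} {l : ℤ} {s : List Step} :
    s ∈ critical m k l ↔ IsCritical m s ∧ s ∈ graded m k l := by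
  refine ⟨fun hs => ?_, fun h => mem_critical_of_mem_criticalFrom ?_
    (mem_criticalFrom_of_isCritical hm h.1 h.2)⟩
  · rw [critical, Finset.mem_union, Finset.mem_union] at hs
    obtain (hs | hs) | hs := hs
    · split_ifs at hs with h
      · obtain rfl : s = [] := by simpa using hs
        exact ⟨.nil, by simp [graded, h]⟩
      · simp at hs
    · exact isCritical_of_mem_criticalFrom hm k hs
    · exact isCritical_of_mem_criticalFrom hm k hs
  · rintro rfl
    exact eq_zero_of_nil_mem_graded h.2

/-- The two families are disjoint because their second steps point in opposite directions. -/
theorem card_criticalFrom_add_two (m k : ℕ) (l : ℤ) (e : Bool) :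
    (criticalFrom m (k + 2) l e).card =
      (criticalFrom m (k + 1) (l - 1) (!e)).card + (critical m k (l - (m + 1))).card := by
  rw [criticalFrom_add_two, Finset.card_union_of_disjoint, Finset.card_image_of_injective _
    (List.cons_injective), Finset.card_image_of_injective]
  · intro r s h
    simpa using h
  · rw [Finset.disjoint_left]
    intro s hs hs'
    obtain ⟨r, hr, rfl⟩ := Finset.mem_image.1 hs
    obtain ⟨r, rfl⟩ := exists_eq_cons_of_mem_criticalFrom hr
    obtain ⟨r', -, h⟩ := Finset.mem_image.1 hs'
    simp at h

theorem card_critical (m k : ℕ) (l : ℤ) :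
    (critical m k l).card = (if k = 0 ∧ l = 0 then 1 else 0) + (criticalFrom m k l true).card +
      (criticalFrom m k l false).card := by
  rw [critical, Finset.card_union_of_disjoint, Finset.card_union_of_disjoint]
  · split_ifs <;> simp
  · rw [Finset.disjoint_left]
    intro s hs hs'
    obtain ⟨r, rfl⟩ := exists_eq_cons_of_mem_criticalFrom hs'
    split_ifs at hs <;> simp at hs
  · rw [Finset.disjoint_left]
    intro s hs hs'
    obtain ⟨r, rfl⟩ := exists_eq_cons_of_mem_criticalFrom hs'
    rw [Finset.mem_union] at hs
    obtain hs | hs := hs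
    · split_ifs at hs <;> simp at hs
    · obtain ⟨r', h⟩ := exists_eq_cons_of_mem_criticalFrom hs
      simp at h

theorem card_critical_zero (m : ℕ) (l : ℤ) :
    (critical m 0 l).card = if l = 0 then 1 else 0 := by
  simp [card_critical, criticalFrom]

theorem card_critical_one (m : ℕ) (l : ℤ) :
    (critical m 1 l).card = if l = 1 then 2 else 0 := by
  rw [card_critical, criticalFrom, criticalFrom]
  split_ifs <;> simp_all

/-- Summing over the initial direction, a turn merely permutes the directions of the shorter words,
while a block may take either direction. The shorter words of the turn have at least one step, so
the empty word plays no role there. -/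
theorem card_critical_add_two (m k : ℕ) (l : ℤ) :
    (critical m (k + 2) l).card =
      (critical m (k + 1) (l - 1)).card + 2 * (critical m k (l - (m + 1))).card := by
  rw [card_critical m (k + 2), card_criticalFrom_add_two, card_criticalFrom_add_two,
    card_critical m (k + 1)]
  simp
  ring

theorem card_critical_of_neg (m k : ℕ) {l : ℤ} (hl : l < 0) : (critical m k l).card = 0 := by
  induction k using Nat.strong_induction_on generalizing l with
  | _ k ih =>
  match k with
  | 0 => rw [card_critical_zero, if_neg (by omega)]
  | 1 => rw [card_critical_one, if_neg (by omega)]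
  | k + 2 =>
    rw [card_critical_add_two, ih (k + 1) (by omega) (by omega), ih k (by omega) (by omega)]

theorem oddCycleT_natCast (m k : ℕ) (l : ℤ) :
    oddCycleT m k l = (2 * m + 1) * (critical m k l).card := by
  induction k using Nat.strong_induction_on generalizing l with
  | _ k ih =>
  by_cases hl : l < 0
  · rw [card_critical_of_neg m k hl, oddCycleT, if_pos (Or.inr hl)]
    simp
  have hneg : ∀ (k l : ℤ), k < 0 → oddCycleT m k l = 0 := fun k l hk => by
    rw [oddCycleT, if_pos (Or.inl hk)]
  rw [oddCycleT, if_neg (by omega)]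
  match k with
  | 0 =>
    rw [card_critical_zero]
    by_cases h : l = 0
    · simp [h]
    · simp [h, hneg]
  | 1 =>
    rw [card_critical_one]
    by_cases h : l = 1
    · simp [h]; ring
    · have h1 := ih 0 (by omega) (l - 1)
      rw [card_critical_zero, if_neg (by omega)] at h1
      simp at h1
      simp [h, hneg, h1]
  | k + 2 =>
    rw [if_neg (by omega), if_neg (by omega), card_critical_add_two,
      show ((k + 2 : ℕ) : ℤ) - 1 = (k + 1 : ℕ) by push_cast; ring,
      show ((k + 2 : ℕ) : ℤ) - 2 = k by push_cast; ring, ih (k + 1) (by omega), ih k (by omega)]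
    push_cast
    ring

/-! ### Ranks and torsion-freeness -/

/-- Critical generators of the magnitude chain group are given by their starting vertices and
their critical words of steps. -/
def criticalEquiv {m : ℕ} (hm : 0 < m) (k : ℕ) (l : ℤ) :
    {x : {x // IsGenerator (oddCycle m) k l x} | IsCritical m (steps m x.1)} ≃
      ZMod (2 * m + 1) × critical m k l where
  toFun x := ((generatorEquiv hm k l x.1).1,
    ⟨steps m x.1.1, (mem_critical_iff hm).2 ⟨x.2, steps_mem_graded hm x.1.2⟩⟩)
  invFun p := ⟨(generatorEquiv hm k l).symm (p.1, ⟨p.2.1, ((mem_critical_iff hm).1 p.2.2).2⟩), by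
    change IsCritical m (steps m (path m p.1 p.2.1))
    rw [steps_path _ ((mem_critical_iff hm).1 p.2.2).2.1]
    exact ((mem_critical_iff hm).1 p.2.2).1⟩
  left_inv x := Subtype.ext ((generatorEquiv hm k l).left_inv x.1)
  right_inv p := by
    have h := (generatorEquiv hm k l).right_inv (p.1, ⟨p.2.1, ((mem_critical_iff hm).1 p.2.2).2⟩)
    exact Prod.ext (congrArg (fun q => q.1) h) (Subtype.ext (congrArg (fun q => q.2.1) h))

/-- If there are finitely many critical generators, then magnitude homology is free of this
rank. -/
theorem MH_of_critical_equiv {m : ℕ} (hm : 0 < m) {k l : ℤ} {ι : Type*} [Fintype ι]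
    (e : {x : {x // IsGenerator (oddCycle m) k l x} | IsCritical m (steps m x.1)} ≃ ι) :
    Module.IsTorsionFree ℤ (MH (oddCycle m) k l) ∧ Module.Finite ℤ (MH (oddCycle m) k l) ∧
      Module.finrank ℤ (MH (oddCycle m) k l) = Fintype.card ι := by
  obtain ⟨f⟩ := nonempty_MH_equiv hm k l
  have g : MH (oddCycle m) k l ≃ₗ[ℤ] (ι →₀ ℤ) :=
    f.trans ((Finsupp.supportedEquivFinsupp _).trans (Finsupp.domLCongr e))
  exact ⟨g.injective.moduleIsTorsionFree g (map_smul g), Module.Finite.equiv g.symm,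
    g.finrank_eq.trans (Module.finrank_finsupp_self ℤ)⟩

/-- Magnitude homology of an odd cycle is free of finite rank, with ranks as in the recursion. -/
theorem MH_oddCycle {m : ℕ} (hm : 0 < m) (k l : ℤ) :
    Module.IsTorsionFree ℤ (MH (oddCycle m) k l) ∧ Module.Finite ℤ (MH (oddCycle m) k l) ∧
      (Module.finrank ℤ (MH (oddCycle m) k l) : ℤ) = oddCycleT m k l := by
  obtain hk | hk := lt_or_ge k 0
  · have : IsEmpty {x : {x // IsGenerator (oddCycle m) k l x} | IsCritical m (steps m x.1)} := by
      refine ⟨fun x => ?_⟩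
      have h1 := x.1.2.length_eq
      have h2 := List.length_pos_iff.2 x.1.2.ne_nil
      omega
    have h := MH_of_critical_equiv hm (@Equiv.equivOfIsEmpty _ (Fin 0) this _)
    refine ⟨h.1, h.2.1, ?_⟩
    rw [h.2.2, oddCycleT, if_pos (Or.inl hk)]
    simp
  · lift k to ℕ using hk
    have h := MH_of_critical_equiv hm (criticalEquiv hm k l)
    refine ⟨h.1, h.2.1, ?_⟩
    rw [h.2.2, oddCycleT_natCast, Fintype.card_prod, ZMod.card, Fintype.card_coe]
    push_cast
    rfl

end MagnitudeHomology

theorem mainTheorem3 (m : ℕ) (hm : 2 ≤ m) (k l : ℤ) :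
    Module.IsTorsionFree ℤ (MagnitudeHomology.MH (SimpleGraph.cycleGraph (2 * m + 1)) k l) ∧
    Module.Finite ℤ (MagnitudeHomology.MH (SimpleGraph.cycleGraph (2 * m + 1)) k l) ∧
    (Module.finrank ℤ (MagnitudeHomology.MH (SimpleGraph.cycleGraph (2 * m + 1)) k l) : ℤ) =
      MagnitudeHomology.oddCycleT m k l :=
  -- `ZMod (2 * m + 1)` unfolds to `Fin (2 * m + 1)`, the vertex type of the cycle graph.
  MagnitudeHomology.MH_oddCycle (by omega) k l
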